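/- Let $q$ be a prime power and let $\mathbb F_q$ be the finite field with $q$ elements. For positive integers $m,n$, the monomial digraph $D(q;m,n)$ has vertex set $\mathbb F_q^2$, and there is an arc from $(x_1,x_2)$ to $(y_1,y_2)$ if and only if $x_2+y_2=x_1^m y_1^n$ (loops are allowed). Since $a^q=a$ for all $a\in\mathbb F_q$, this digraph depends only on the residues of $m,n$ modulo $q-1$. Write $\cong$ for isomorphism of digraphs, and let $m,n,m_1,n_1,m_2,n_2$ be integers in $\{1,\dots,q-1\}$. Then the following statements hold. (i) If $\gcd(m,q-1)=1$, then $D(q;m,n)\cong D(q;1,n')$ for some integer $n'\in\{1,\dots,q-1\}$ such that $mn'\equiv n \pmod{q-1}$. (ii) If $mn\equiv 1\pmod{q-1}$, then $D(q;m,1)\cong D(q;1,n)$, and $D(q;m,n)\cong D(q;1,n^2)\cong D(q;m^2,1)$. (iii) If $m+n\equiv 0\pmod{q-1}$, then $D(q;m,n)\cong D(q;n,m)$. (iv) If $D(q;m_1,n_1)\cong D(q;m_2,n_2)$ and $m_1=n_1$, then $m_2=n_2$ and $\gcd(m_1,q-1)=\gcd(m_2,q-1)$. (v) If $\gcd(m,q-1)=\gcd(n,q-1)$,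 then $D(q;m,m)\cong D(q;n,n)$. -/

import Mathlib

/-- The algebraically defined digraph `D(q; f)` of a function `f : F × F → F` (curried): its vertex
set is `F × F`, and there is an arc from `(x₁, x₂)` to `(y₁, y₂)` iff `x₂ + y₂ = f x₁ y₁`.
Loops are allowed. -/
def algebraicDigraph {F : Type*} [Add F] (f : F → F → F) : Digraph (F × F) where
  Adj x y := x.2 + y.2 = f x.1 y.1

/-- The monomial digraph `D(q; m, n)` over `F`, the case `f x y = x ^ m * y ^ n`. -/
def monomialDigraph (F : Type*) [Field F] (m n : ℕ) : Digraph (F × F) :=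
  algebraicDigraph fun x y => x ^ m * y ^ n

/-- Two digraphs are isomorphic: some bijection of the vertex sets preserves arcs and non-arcs. -/
def Digraph.IsIsomorphic {V W : Type*} (D : Digraph V) (E : Digraph W) : Prop :=
  ∃ φ : V ≃ W, ∀ u v : V, E.Adj (φ u) (φ v) ↔ D.Adj u v

/-! A power map with exponent invertible modulo `q - 1` permutes the first coordinates and
multiplies both exponents by a unit; this yields (i), (ii), (v) through
`monomialDigraph_isIsomorphic_of_modEq`, and inversion, the exponent `-1`, yields (iii). For (iv),
equal exponents are detected by symmetry of the arc relation (`modEq_of_monomialDigraph_symm`), and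
the gcd by counting common out-neighbours (`gcd_eq_of_isIsomorphic`). -/

theorem FiniteField.pow_eq_pow_of_modEq {F : Type*} [Field F] [Fintype F] {a b : ℕ}
    (ha : a ≠ 0) (hb : b ≠ 0) (h : a ≡ b [MOD Fintype.card F - 1]) (x : F) :
    x ^ a = x ^ b := by
  rcases eq_or_ne x 0 with rfl | hx
  · rw [zero_pow ha, zero_pow hb]
  · rw [pow_eq_pow_mod a (FiniteField.pow_card_sub_one_eq_one x hx),
      pow_eq_pow_mod b (FiniteField.pow_card_sub_one_eq_one x hx), h]

/-- The power map `x ↦ x ^ a` of a finite field, for `a` invertible modulo `|F| - 1`, with inverse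
`x ↦ x ^ b`. -/
def FiniteField.powEquiv (F : Type*) [Field F] [Fintype F] {a b : ℕ} (ha : a ≠ 0) (hb : b ≠ 0)
    (h : a * b ≡ 1 [MOD Fintype.card F - 1]) : F ≃ F where
  toFun x := x ^ a
  invFun x := x ^ b
  left_inv x := by
    beta_reduce
    rw [← pow_mul, FiniteField.pow_eq_pow_of_modEq (mul_ne_zero ha hb) one_ne_zero h, pow_one]
  right_inv x := by
    beta_reduce
    rw [← pow_mul, mul_comm, FiniteField.pow_eq_pow_of_modEq (mul_ne_zero ha hb) one_ne_zero h,
      pow_one]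

theorem algebraicDigraph_isIsomorphic_of_equiv {F : Type*} [Add F] {f g : F → F → F} (σ : F ≃ F)
    (h : ∀ x y, g (σ x) (σ y) = f x y) :
    (algebraicDigraph f).IsIsomorphic (algebraicDigraph g) :=
  ⟨σ.prodCongr (Equiv.refl F), fun u v => by simp [algebraicDigraph, h]⟩

/-- If `a` is invertible modulo `|F| - 1`, with `a * m' ≡ m` and `a * n' ≡ n`, then the power map
`x ↦ x ^ a` gives an isomorphism `D(q; m, n) ≅ D(q; m', n')`. -/
theorem monomialDigraph_isIsomorphic_of_modEq {F : Type*} [Field F] [Fintype F]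
    {a b m n m' n' : ℕ} (ha : a ≠ 0) (hb : b ≠ 0) (hab : a * b ≡ 1 [MOD Fintype.card F - 1])
    (hm₀ : m ≠ 0) (hn₀ : n ≠ 0) (hm₀' : m' ≠ 0) (hn₀' : n' ≠ 0)
    (hm : a * m' ≡ m [MOD Fintype.card F - 1]) (hn : a * n' ≡ n [MOD Fintype.card F - 1]) :
    (monomialDigraph F m n).IsIsomorphic (monomialDigraph F m' n') := by
  refine algebraicDigraph_isIsomorphic_of_equiv (FiniteField.powEquiv F ha hb hab) fun x y => ?_
  change (x ^ a) ^ m' * (y ^ a) ^ n' = x ^ m * y ^ n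
  rw [← pow_mul, ← pow_mul, FiniteField.pow_eq_pow_of_modEq (mul_ne_zero ha hm₀') hm₀ hm,
    FiniteField.pow_eq_pow_of_modEq (mul_ne_zero ha hn₀') hn₀ hn]

/-! ### Residues and units modulo `N` -/

/-- Every residue class modulo `N ≥ 1` has a representative in `{1, …, N}`. -/
theorem Nat.exists_mem_Icc_one_modEq {N : ℕ} (hN : 1 ≤ N) (a : ℕ) :
    ∃ r ∈ Set.Icc 1 N, r ≡ a [MOD N] := by
  rcases Nat.eq_zero_or_pos (a % N) with h | h
  · exact ⟨N, ⟨hN, le_rfl⟩, by simp [Nat.ModEq, h]⟩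
  · exact ⟨a % N, ⟨h, (Nat.mod_lt a hN).le⟩, Nat.mod_modEq a N⟩

/-- Two naturals with the same gcd with `N` differ modulo `N` by a unit of `ZMod N`. -/
theorem ZMod.exists_unit_mul_eq_of_gcd_eq {N m n : ℕ} (h : Nat.gcd m N = Nat.gcd n N) :
    ∃ u : (ZMod N)ˣ, (u : ZMod N) * m = n := by
  have key : ∀ k : ℕ, ∃ u : (ZMod N)ˣ, (k : ZMod N) = u * (Nat.gcd k N : ℕ) := by
    intro k
    obtain ⟨d, hd, u, hu, hk⟩ := (k : ZMod N).eq_unit_mul_divisor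
    obtain ⟨u, rfl⟩ := hu
    suffices hdk : Nat.gcd k N = d by exact ⟨u, by rw [hdk, hk]⟩
    -- A unit stays a unit after reduction modulo a divisor of `N`, so `k` and `d` share the same
    -- divisors among those of `N`.
    have hdvd : ∀ a : ℕ, a ∣ N → ((a ∣ k) ↔ a ∣ d) := by
      intro a ha
      have hcast : (ZMod.castHom ha (ZMod a)) (k : ZMod N) =
          (ZMod.castHom ha (ZMod a)) u * (ZMod.castHom ha (ZMod a)) (d : ZMod N) := by
        rw [hk, map_mul]
      rw [map_natCast, map_natCast] at hcast
      rw [← ZMod.natCast_eq_zero_iff, ← ZMod.natCast_eq_zero_iff, hcast,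
        (u.isUnit.map (ZMod.castHom ha (ZMod a))).mul_right_eq_zero]
    exact Nat.dvd_antisymm ((hdvd _ (Nat.gcd_dvd_right k N)).1 (Nat.gcd_dvd_left k N))
      (Nat.dvd_gcd ((hdvd d hd).2 dvd_rfl) hd)
  obtain ⟨u, hu⟩ := key m
  obtain ⟨v, hv⟩ := key n
  refine ⟨v * u⁻¹, ?_⟩
  rw [hv, ← h, hu, Units.val_mul, mul_assoc, Units.inv_mul_cancel_left]

/-- Naturals representing a unit of `ZMod N` and its inverse, both positive. -/
theorem ZMod.exists_natCast_eq_unit {N : ℕ} (hN : 1 ≤ N) (u : (ZMod N)ˣ) :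
    ∃ a b : ℕ, a ≠ 0 ∧ b ≠ 0 ∧ (a : ZMod N) = u ∧ a * b ≡ 1 [MOD N] := by
  have : NeZero N := ⟨by omega⟩
  have key : ∀ z : ZMod N, ∃ a : ℕ, a ≠ 0 ∧ (a : ZMod N) = z := fun z =>
    ⟨z.val + N, by omega, by simp⟩
  obtain ⟨a, ha, hau⟩ := key u
  obtain ⟨b, hb, hbu⟩ := key ↑u⁻¹
  refine ⟨a, b, ha, hb, hau, ?_⟩
  rw [← ZMod.natCast_eq_natCast_iff, Nat.cast_mul, hau, hbu, Nat.cast_one, Units.mul_inv]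

/-! ### Common out-neighbours and the gcd invariant -/

theorem FiniteField.card_pow_eq_one {F : Type*} [Field F] [Fintype F] {m : ℕ} (hm : m ≠ 0) :
    Nat.card {y : F // y ^ m = 1} = Nat.gcd m (Fintype.card F - 1) := by
  classical
  have h := IsCyclic.card_powMonoidHom_ker Fˣ m
  rw [Nat.card_eq_fintype_card (α := Fˣ), Fintype.card_units, Nat.gcd_comm] at h
  rw [← h]
  refine Nat.card_congr
    ⟨fun y => ⟨Units.mk0 y.1 fun h0 => ?_, ?_⟩, fun y => ⟨y.1, ?_⟩, fun y => ?_, fun y => ?_⟩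
  · have := y.2
    rw [h0, zero_pow hm] at this
    exact zero_ne_one this
  · rw [MonoidHom.mem_ker, powMonoidHom_apply]
    ext
    simpa using y.2
  · have := y.2
    rw [MonoidHom.mem_ker, powMonoidHom_apply] at this
    simpa using congrArg Units.val this
  · rfl
  · ext
    rfl

/-- A nonempty fibre of the `m`-th power map over a nonzero element has `gcd (m, |F| - 1)`
elements. -/
theorem FiniteField.card_pow_eq_pow {F : Type*} [Field F] [Fintype F] {m : ℕ} (hm : m ≠ 0) {z : F}
    (hz : z ≠ 0) : Nat.card {y : F // y ^ m = z ^ m} = Nat.gcd m (Fintype.card F - 1) := by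
  rw [← FiniteField.card_pow_eq_one hm]
  refine Nat.card_congr ((Equiv.divRight₀ z hz).subtypeEquiv fun y => ?_)
  rw [Equiv.divRight₀_apply, div_pow, div_eq_one_iff_eq (pow_ne_zero m hz)]

/-- The number of common out-neighbours of two vertices of a digraph. -/
noncomputable def Digraph.codegree {V : Type*} (D : Digraph V) (u v : V) : ℕ :=
  Nat.card {w // D.Adj u w ∧ D.Adj v w}

theorem Digraph.codegree_map {V W : Type*} {D : Digraph V} {E : Digraph W} (φ : V ≃ W)
    (h : ∀ u v, E.Adj (φ u) (φ v) ↔ D.Adj u v) (u v : V) :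
    E.codegree (φ u) (φ v) = D.codegree u v :=
  (Nat.card_congr (φ.subtypeEquiv fun w => by rw [h, h])).symm

/-- Subtracting the two arc equations eliminates the second coordinate of the common neighbour,
which either equation recovers from the first coordinate. -/
theorem codegree_monomialDigraph {F : Type*} [Field F] (m n : ℕ) (u v : F × F) :
    (monomialDigraph F m n).codegree u v =
      Nat.card {y : F // u.2 - v.2 = (u.1 ^ m - v.1 ^ m) * y ^ n} := by
  refine Nat.card_congr
    ⟨fun w => ⟨w.1.1, ?_⟩, fun y => ⟨(y.1, u.1 ^ m * y.1 ^ n - u.2), ?_, ?_⟩, fun w => ?_,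
      fun y => ?_⟩
  · have h₁ : u.2 + w.1.2 = u.1 ^ m * w.1.1 ^ n := w.2.1
    have h₂ : v.2 + w.1.2 = v.1 ^ m * w.1.1 ^ n := w.2.2
    linear_combination h₁ - h₂
  · change u.2 + (u.1 ^ m * y.1 ^ n - u.2) = u.1 ^ m * y.1 ^ n
    ring
  · change v.2 + (u.1 ^ m * y.1 ^ n - u.2) = v.1 ^ m * y.1 ^ n
    linear_combination -y.2
  · have h₁ : u.2 + w.1.2 = u.1 ^ m * w.1.1 ^ n := w.2.1
    refine Subtype.ext (Prod.ext rfl ?_)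
    change u.1 ^ m * w.1.1 ^ n - u.2 = w.1.2
    linear_combination -h₁
  · rfl

/-- The values come, in order, from an unsolvable equation, the solution `y = 0` alone, the trivial
equation `0 = 0`, and a coset of the `n`-th roots of unity. -/
theorem codegree_monomialDigraph_mem {F : Type*} [Field F] [Fintype F] (m : ℕ) {n : ℕ}
    (hn : n ≠ 0) (u v : F × F) :
    (monomialDigraph F m n).codegree u v ∈
      ({0, 1, Fintype.card F, Nat.gcd n (Fintype.card F - 1)} : Set ℕ) := by
  rw [codegree_monomialDigraph]
  generalize u.2 - v.2 = b
  generalize u.1 ^ m - v.1 ^ m = a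
  rcases isEmpty_or_nonempty {y : F // b = a * y ^ n} with he | ⟨z, rfl⟩
  · exact Or.inl (by simp)
  rcases eq_or_ne a 0 with rfl | ha
  · exact Or.inr (Or.inr (Or.inl (by simp)))
  have hiff : ∀ y : F, a * z ^ n = a * y ^ n ↔ y ^ n = z ^ n := fun y => by
    rw [mul_right_inj' ha, eq_comm]
  simp only [hiff]
  rcases eq_or_ne z 0 with rfl | hz
  · exact Or.inr (Or.inl (by simp [zero_pow hn, pow_eq_zero_iff hn]))
  · exact Or.inr (Or.inr (Or.inr (FiniteField.card_pow_eq_pow hn hz)))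

theorem exists_codegree_monomialDigraph_eq_gcd {F : Type*} [Field F] [Fintype F] {m n : ℕ}
    (hm : m ≠ 0) (hn : n ≠ 0) :
    ∃ u v, (monomialDigraph F m n).codegree u v = Nat.gcd n (Fintype.card F - 1) := by
  -- For this pair the equation for `y` becomes `1 = y ^ n`.
  refine ⟨(1, 1), (0, 0), ?_⟩
  rw [codegree_monomialDigraph, ← FiniteField.card_pow_eq_one (F := F) hn]
  simp [zero_pow hm, eq_comm]

/-- The attained codegree must be one of the four values for the second digraph; its size rules out
`0` and `q`. The leftover value `1` is removed by applying the result in both directions. -/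
theorem gcd_eq_one_or_eq_of_isIsomorphic {F : Type*} [Field F] [Fintype F] {m₁ n₁ m₂ n₂ : ℕ}
    (hm₁ : m₁ ≠ 0) (hn₁ : n₁ ≠ 0) (hn₂ : n₂ ≠ 0)
    (h : (monomialDigraph F m₁ n₁).IsIsomorphic (monomialDigraph F m₂ n₂)) :
    Nat.gcd n₁ (Fintype.card F - 1) = 1 ∨
      Nat.gcd n₁ (Fintype.card F - 1) = Nat.gcd n₂ (Fintype.card F - 1) := by
  have hq : 1 < Fintype.card F := Fintype.one_lt_card
  obtain ⟨φ, hφ⟩ := h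
  obtain ⟨u, v, huv⟩ := exists_codegree_monomialDigraph_eq_gcd (F := F) hm₁ hn₁
  have hmem := codegree_monomialDigraph_mem m₂ hn₂ (φ u) (φ v)
  rw [Digraph.codegree_map φ hφ, huv] at hmem
  have hpos : 0 < Nat.gcd n₁ (Fintype.card F - 1) := Nat.gcd_pos_of_pos_left _ (by omega)
  have hle : Nat.gcd n₁ (Fintype.card F - 1) ≤ Fintype.card F - 1 :=
    Nat.le_of_dvd (by omega) (Nat.gcd_dvd_right _ _)
  rcases hmem with h0 | h1 | hc | he
  · omega
  · exact Or.inl h1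
  · omega
  · exact Or.inr he

theorem Digraph.IsIsomorphic.symm {V W : Type*} {D : Digraph V} {E : Digraph W}
    (h : D.IsIsomorphic E) : E.IsIsomorphic D := by
  obtain ⟨φ, hφ⟩ := h
  exact ⟨φ.symm, fun u v => by rw [← hφ, φ.apply_symm_apply, φ.apply_symm_apply]⟩

/-- The gcd of the second exponent with `|F| - 1` is an isomorphism invariant. -/
theorem gcd_eq_of_isIsomorphic {F : Type*} [Field F] [Fintype F] {m₁ n₁ m₂ n₂ : ℕ}
    (hm₁ : m₁ ≠ 0) (hn₁ : n₁ ≠ 0) (hm₂ : m₂ ≠ 0) (hn₂ : n₂ ≠ 0)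
    (h : (monomialDigraph F m₁ n₁).IsIsomorphic (monomialDigraph F m₂ n₂)) :
    Nat.gcd n₁ (Fintype.card F - 1) = Nat.gcd n₂ (Fintype.card F - 1) := by
  rcases gcd_eq_one_or_eq_of_isIsomorphic hm₁ hn₁ hn₂ h with h₁ | h₁
  · rcases gcd_eq_one_or_eq_of_isIsomorphic hm₂ hn₂ hn₁ h.symm with h₂ | h₂
    · rw [h₁, h₂]
    · exact h₂.symm
  · exact h₁

/-! ### Symmetry of the arc relation -/

theorem monomialDigraph_adj_symm {F : Type*} [Field F] (m : ℕ) {u v : F × F}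
    (h : (monomialDigraph F m m).Adj u v) : (monomialDigraph F m m).Adj v u := by
  change u.2 + v.2 = u.1 ^ m * v.1 ^ m at h
  change v.2 + u.2 = v.1 ^ m * u.1 ^ m
  rw [add_comm, h, mul_comm]

theorem FiniteField.modEq_of_pow_eq_pow {F : Type*} [Field F] [Fintype F] {m n : ℕ}
    (h : ∀ x : F, x ^ m = x ^ n) : m ≡ n [MOD Fintype.card F - 1] := by
  classical
  obtain ⟨g, hg⟩ := IsCyclic.exists_generator (α := Fˣ)
  have hord : orderOf g = Fintype.card F - 1 := by
    rw [orderOf_eq_card_of_forall_mem_zpowers hg, Nat.card_eq_fintype_card, Fintype.card_units]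
  rw [← hord, ← pow_eq_pow_iff_modEq]
  ext
  simpa using h g

/-- A monomial digraph whose arc relation is symmetric has congruent exponents. -/
theorem modEq_of_monomialDigraph_symm {F : Type*} [Field F] [Fintype F] {m n : ℕ}
    (h : ∀ u v, (monomialDigraph F m n).Adj u v → (monomialDigraph F m n).Adj v u) :
    m ≡ n [MOD Fintype.card F - 1] := by
  refine FiniteField.modEq_of_pow_eq_pow fun x => ?_
  -- Reversing this arc gives exactly `x ^ m = x ^ n`.
  have hadj : (monomialDigraph F m n).Adj (x, 0) (1, x ^ m) := by
    change 0 + x ^ m = x ^ m * 1 ^ n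
    simp
  have hsymm : x ^ m + 0 = 1 ^ m * x ^ n := h _ _ hadj
  simpa using hsymm

theorem Nat.ModEq.eq_of_mem_Icc_one {N a b : ℕ} (h : a ≡ b [MOD N]) (ha : a ∈ Set.Icc 1 N)
    (hb : b ∈ Set.Icc 1 N) : a = b := by
  obtain ⟨ha₁, ha₂⟩ := ha
  obtain ⟨hb₁, hb₂⟩ := hb
  have h' : (a - 1) ≡ (b - 1) [MOD N] := by
    apply Nat.ModEq.add_right_cancel' 1
    rwa [Nat.sub_add_cancel ha₁, Nat.sub_add_cancel hb₁]
  have := h'.eq_of_lt_of_lt (by omega) (by omega)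
  omega

/-- Inversion swaps the two exponents because `n ≡ -m`; the convention `0⁻¹ = 0` makes it a
bijection of all of `F`. -/
theorem monomialDigraph_swap_isIsomorphic {F : Type*} [Field F] [Fintype F] {m n : ℕ}
    (hm : m ≠ 0) (hn : n ≠ 0) (h : m + n ≡ 0 [MOD Fintype.card F - 1]) :
    (monomialDigraph F m n).IsIsomorphic (monomialDigraph F n m) := by
  have hinv : ∀ x : F, x⁻¹ ^ n = x ^ m ∧ x⁻¹ ^ m = x ^ n := by
    intro x
    rcases eq_or_ne x 0 with rfl | hx
    · simp [zero_pow hm, zero_pow hn]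
    have hmn : x ^ m * x ^ n = 1 := by
      obtain ⟨k, hk⟩ := (Nat.modEq_zero_iff_dvd).1 h
      rw [← pow_add, hk, pow_mul, FiniteField.pow_card_sub_one_eq_one x hx, one_pow]
    rw [inv_pow, inv_pow]
    exact ⟨inv_eq_of_mul_eq_one_left hmn, inv_eq_of_mul_eq_one_right hmn⟩
  refine algebraicDigraph_isIsomorphic_of_equiv ((inv_involutive (G := F)).toPerm _) fun x y => ?_
  change x⁻¹ ^ n * y⁻¹ ^ m = x ^ m * y ^ n
  rw [(hinv x).1, (hinv y).2]

theorem mainTheorem4 {F : Type*} [Field F] [Fintype F] (q : ℕ) (hq : Fintype.card F = q) :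
    -- (i)
    (∀ m ∈ Set.Icc 1 (q - 1), ∀ n ∈ Set.Icc 1 (q - 1), Nat.gcd m (q - 1) = 1 →
      ∃ n' ∈ Set.Icc 1 (q - 1), m * n' ≡ n [MOD q - 1] ∧
        (monomialDigraph F m n).IsIsomorphic (monomialDigraph F 1 n')) ∧
    -- (ii)
    (∀ m ∈ Set.Icc 1 (q - 1), ∀ n ∈ Set.Icc 1 (q - 1), m * n ≡ 1 [MOD q - 1] →
      (monomialDigraph F m 1).IsIsomorphic (monomialDigraph F 1 n) ∧
      (monomialDigraph F m n).IsIsomorphic (monomialDigraph F 1 (n ^ 2)) ∧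
      (monomialDigraph F 1 (n ^ 2)).IsIsomorphic (monomialDigraph F (m ^ 2) 1)) ∧
    -- (iii)
    (∀ m ∈ Set.Icc 1 (q - 1), ∀ n ∈ Set.Icc 1 (q - 1), m + n ≡ 0 [MOD q - 1] →
      (monomialDigraph F m n).IsIsomorphic (monomialDigraph F n m)) ∧
    -- (iv)
    (∀ m₁ ∈ Set.Icc 1 (q - 1), ∀ n₁ ∈ Set.Icc 1 (q - 1),
      ∀ m₂ ∈ Set.Icc 1 (q - 1), ∀ n₂ ∈ Set.Icc 1 (q - 1),
      (monomialDigraph F m₁ n₁).IsIsomorphic (monomialDigraph F m₂ n₂) → m₁ = n₁ →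
        m₂ = n₂ ∧ Nat.gcd m₁ (q - 1) = Nat.gcd m₂ (q - 1)) ∧
    -- (v)
    (∀ m ∈ Set.Icc 1 (q - 1), ∀ n ∈ Set.Icc 1 (q - 1),
      Nat.gcd m (q - 1) = Nat.gcd n (q - 1) →
      (monomialDigraph F m m).IsIsomorphic (monomialDigraph F n n)) := by
  subst hq
  have hN : 1 ≤ Fintype.card F - 1 := Nat.le_sub_one_of_lt Fintype.one_lt_card
  refine ⟨?_, ?_, ?_, ?_, ?_⟩
  · intro m hm n hn hgcd
    have hm₀ : m ≠ 0 := Nat.one_le_iff_ne_zero.1 hm.1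
    have hn₀ : n ≠ 0 := Nat.one_le_iff_ne_zero.1 hn.1
    obtain ⟨a, b, -, hb, ha, hab⟩ :=
      ZMod.exists_natCast_eq_unit hN (ZMod.unitOfCoprime m hgcd)
    rw [ZMod.coe_unitOfCoprime, ZMod.natCast_eq_natCast_iff] at ha
    have hmb : m * b ≡ 1 [MOD Fintype.card F - 1] := (ha.symm.mul_right b).trans hab
    -- Since `b` inverts `m`, the sought `n'` is the representative of `b * n`.
    obtain ⟨r, hr, hrb⟩ := Nat.exists_mem_Icc_one_modEq hN (b * n)
    have hmr : m * r ≡ n [MOD Fintype.card F - 1] := by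
      refine (hrb.mul_left m).trans ?_
      simpa [mul_assoc] using hmb.mul_right n
    exact ⟨r, hr, hmr, monomialDigraph_isIsomorphic_of_modEq hm₀ hb hmb hm₀ hn₀ one_ne_zero
      (Nat.one_le_iff_ne_zero.1 hr.1) (by rw [mul_one]) hmr⟩
  · intro m hm n hn hmn
    have hm₀ : m ≠ 0 := Nat.one_le_iff_ne_zero.1 hm.1
    have hn₀ : n ≠ 0 := Nat.one_le_iff_ne_zero.1 hn.1
    have hmnn : m * n ^ 2 ≡ n [MOD Fintype.card F - 1] := by
      simpa [pow_two, mul_assoc] using hmn.mul_right n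
    have hsq : n ^ 2 * m ^ 2 ≡ 1 [MOD Fintype.card F - 1] := by
      simpa [mul_pow, mul_comm] using hmn.pow 2
    -- The power maps have exponents `m`, `m` and `n ^ 2`.
    exact ⟨monomialDigraph_isIsomorphic_of_modEq hm₀ hn₀ hmn hm₀ one_ne_zero one_ne_zero hn₀
        (by rw [mul_one]) hmn,
      monomialDigraph_isIsomorphic_of_modEq hm₀ hn₀ hmn hm₀ hn₀ one_ne_zero (pow_ne_zero 2 hn₀)
        (by rw [mul_one]) hmnn,
      monomialDigraph_isIsomorphic_of_modEq (pow_ne_zero 2 hn₀) (pow_ne_zero 2 hm₀) hsq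
        one_ne_zero (pow_ne_zero 2 hn₀) (pow_ne_zero 2 hm₀) one_ne_zero hsq (by rw [mul_one])⟩
  · intro m hm n hn hmn
    exact monomialDigraph_swap_isIsomorphic (Nat.one_le_iff_ne_zero.1 hm.1)
      (Nat.one_le_iff_ne_zero.1 hn.1) hmn
  · rintro m₁ hm₁ n₁ hn₁ m₂ hm₂ n₂ hn₂ hiso rfl
    have hm₁₀ : m₁ ≠ 0 := Nat.one_le_iff_ne_zero.1 hm₁.1
    have hm₂₀ : m₂ ≠ 0 := Nat.one_le_iff_ne_zero.1 hm₂.1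
    have heq : m₂ = n₂ := by
      refine (modEq_of_monomialDigraph_symm (F := F) fun u v huv => ?_).eq_of_mem_Icc_one hm₂ hn₂
      obtain ⟨φ, hφ⟩ := hiso.symm
      exact (hφ v u).1 (monomialDigraph_adj_symm m₁ ((hφ u v).2 huv))
    subst heq
    exact ⟨rfl, gcd_eq_of_isIsomorphic hm₁₀ hm₁₀ hm₂₀ hm₂₀ hiso⟩
  · intro m hm n hn hgcd
    have hm₀ : m ≠ 0 := Nat.one_le_iff_ne_zero.1 hm.1
    have hn₀ : n ≠ 0 := Nat.one_le_iff_ne_zero.1 hn.1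
    -- As both exponents coincide, a single unit carrying `n` to `m` handles them together.
    obtain ⟨u, hu⟩ := ZMod.exists_unit_mul_eq_of_gcd_eq hgcd.symm
    obtain ⟨a, b, ha, hb, hau, hab⟩ := ZMod.exists_natCast_eq_unit hN u
    have han : a * n ≡ m [MOD Fintype.card F - 1] := by
      rw [← ZMod.natCast_eq_natCast_iff, Nat.cast_mul, hau, hu]
    exact monomialDigraph_isIsomorphic_of_modEq ha hb hab hm₀ hm₀ hn₀ hn₀ han han
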